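/- A graph is a finite multigraph (loops and parallel edges allowed, connectedness not required). A *plane graph* is a graph drawn in the plane: vertices are distinct points, and edges are simple curves (simple closed curves for loops) joining their ends, whose interiors are pairwise disjoint and contain no vertex; as usual the curves are taken to be tame, namely straight near their ends (e.g. polygonal arcs). A *face* is a connected component of the complement of the drawing. A *facial path* is a path $v_0,e_1,v_1,\dots,e_m,v_m$ of the graph (the $v_i$ being distinct) that consists of consecutive vertices and edges on the boundary walk of some face. An edge-coloring is *facially non-repetitive* if for no facial path with an even number $2j\ge 2$ of edges the color sequence of its first half equals the color sequence of its second half. The *facial Thue choice index* $\pi'_{fl}(G)$ is the least integer $k$ such that, whenever every edge $e$ of $G$ is given a list $L(e)$ of at least $k$ colors, $G$ has a facially non-repetitive edge-coloring $c$ with $c(e)\in L(e)$ for all edges $e$. **Corollary.** Every plane graph $G$ satisfies $\pi'_{fl}(G)\le 10$. Moreover, the same bound $\pi'_{fl}(G)\le 10$ holds for every graph $G$ embedded on an arbitrary surface, orientable or not, where the embedding is given by a rotation system together with a signature of the edges, and the boundary walks of the faces are those obtained by face traversal. -/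

import Mathlib

/-! ### Multigraphs, darts and paths -/

/-- A multigraph (loops and parallel edges allowed) with vertex set `V` and edge set `E`.
Each edge `e` has two darts (its two orientations) `(e, false)` and `(e, true)`, and
`tail d` is the vertex at which the dart `d` starts. -/
structure Multigraph (V E : Type*) where
  tail : E × Bool → V

namespace Multigraph

variable {V E : Type*}

/-- The oppositely oriented dart of the same edge. -/
def rev (d : E × Bool) : E × Bool := (d.1, !d.2)

/-- The vertex at which a dart ends. -/
def head (G : Multigraph V E) (d : E × Bool) : V := G.tail (rev d)

/-- The list of vertices visited by a list of darts. -/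
def support (G : Multigraph V E) : List (E × Bool) → List V
  | [] => []
  | d :: l => G.tail d :: (d :: l).map G.head

/-- A path: a walk (each dart starts where the preceding one ends) without repeated vertex. -/
def IsPath (G : Multigraph V E) (p : List (E × Bool)) : Prop :=
  p.IsChain (fun d d' => G.head d = G.tail d') ∧ (G.support p).Nodup

end Multigraph

/-! ### Repetitions and the choice index -/

/-- A word is a repetition if it is a nonempty word written twice. -/
def IsRepetition {C : Type*} (w : List C) : Prop := ∃ u : List C, u ≠ [] ∧ w = u ++ u

/-- With respect to a given set of facial paths, the edge-coloring `c` is facially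
non-repetitive: the colors along a facial path never form a repetition. -/
def FaciallyNonRepetitive {E C : Type*} (facial : Set (List (E × Bool))) (c : E → C) : Prop :=
  ∀ p ∈ facial, ¬ IsRepetition (p.map fun d => c d.1)

/-- Facial non-repetitive edge `k`-choosability: whatever lists of at least `k` colors the edges
receive, there is a facially non-repetitive edge-coloring from the lists. -/
def FaciallyEdgeChoosable {E : Type*} (facial : Set (List (E × Bool))) (k : ℕ) : Prop :=
  ∀ L : E → Finset ℕ, (∀ e, k ≤ (L e).card) →
    ∃ c : E → ℕ, (∀ e, c e ∈ L e) ∧ FaciallyNonRepetitive facial c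

/-- The least `k` such that facial non-repetitive edge `k`-choosability holds
(`⊤` if there is none). -/
noncomputable def facialChoiceIndex {E : Type*} (facial : Set (List (E × Bool))) : ℕ∞ :=
  ⨅ (k : ℕ) (_ : FaciallyEdgeChoosable facial k), (k : ℕ∞)

/-! ### Plane graphs -/

/-- The angle in `(0, 2π]` by which the direction of `u` is turned counterclockwise to reach
the direction of `w`. -/
noncomputable def ccwAngle (u w : ℂ) : ℝ := toIocMod Real.two_pi_pos 0 (w / u).arg

/-- The open sector with apex `v` swept when turning counterclockwise from direction `u` to
direction `w` (the ray of direction `u`, and `v` itself, have angle `2π` and are left out). -/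
def openSector (v u w : ℂ) : Set ℂ := {z | ccwAngle u (z - v) < ccwAngle u w}

/-- A multigraph drawn in the plane `ℂ`: vertices are distinct points, edges are simple curves
(simple closed curves in the case of loops) joining their ends, whose interiors contain no vertex
and are pairwise disjoint. Edges are straight near their ends (as polygonal arcs are), so that the
darts at a vertex have directions there. -/
structure PlaneGraph (V E : Type*) extends Multigraph V E where
  pos : V → ℂ
  pos_injective : Function.Injective pos
  arc : E → C(unitInterval, ℂ)
  arc_zero : ∀ e, arc e 0 = pos (tail (e, false))
  arc_one : ∀ e, arc e 1 = pos (tail (e, true))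
  arc_ne_pos : ∀ e, ∀ t ∈ Set.Ioo (0 : unitInterval) 1, ∀ v, arc e t ≠ pos v
  arc_injective : ∀ e e', ∀ t ∈ Set.Ioo (0 : unitInterval) 1, ∀ t' ∈ Set.Ioo (0 : unitInterval) 1,
    arc e t = arc e' t' → e = e' ∧ t = t'
  /-- A direction in which the dart leaves its tail. -/
  dir : E × Bool → ℂ
  dir_ne_zero : ∀ d, dir d ≠ 0
  /-- An initial piece of the dart is the segment from its tail `x` to `x + dir d`. -/
  straight : ∀ d : E × Bool, ∃ δ : unitInterval, 0 < δ ∧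
    (fun t => arc d.1 (if d.2 then unitInterval.symm t else t)) '' Set.Iic δ =
      segment ℝ (pos (tail d)) (pos (tail d) + dir d)

namespace PlaneGraph

variable {V E : Type*} (G : PlaneGraph V E)

/-- The set of points of the plane covered by the graph. -/
def pointSet : Set ℂ := Set.range G.pos ∪ ⋃ e, Set.range (G.arc e)

/-- A face: a connected component of the complement of the graph in the plane. -/
def IsFace (F : Set ℂ) : Prop := ∃ z ∈ G.pointSetᶜ, F = connectedComponentIn G.pointSetᶜ z

/-- The dart `d'` follows the dart `d` on the boundary walk of the face `F`, traversed with `F` on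
its left: `d'` starts at the vertex where `d` ends, and near that vertex the angle on the left of
`d` and `d'`, i.e. the sector counterclockwise from `d'` to the reverse of `d`, lies in `F`. -/
def FollowsOn (F : Set ℂ) (d d' : E × Bool) : Prop :=
  G.head d = G.tail d' ∧ ∃ ε > 0,
    Metric.ball (G.pos (G.tail d')) ε ∩
      openSector (G.pos (G.tail d')) (G.dir d') (G.dir (Multigraph.rev d)) ⊆ F

/-- The facial paths: paths of consecutive darts on the boundary walk of some face. -/
def facialPaths : Set (List (E × Bool)) :=
  {p | G.IsPath p ∧ ∃ F, G.IsFace F ∧ p.IsChain (G.FollowsOn F)}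

/-- The facial Thue choice index of a plane graph. -/
noncomputable def facialThueChoiceIndex : ℕ∞ := facialChoiceIndex G.facialPaths

end PlaneGraph

/-! ### Graphs embedded on arbitrary surfaces -/

/-- A multigraph embedded on a surface, orientable or not, given by its rotation system and
signature: `rot` sends each dart to the next one in the cyclic order around its tail (with respect
to a local orientation chosen at the tail), and `sign e = -1` if and only if the local orientations
at the two ends of `e` disagree along `e`. -/
structure SurfaceGraph (V E : Type*) extends Multigraph V E where
  rot : Equiv.Perm (E × Bool)
  sameCycle_rot_iff : ∀ d d', rot.SameCycle d d' ↔ tail d = tail d'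
  sign : E → ℤˣ

namespace SurfaceGraph

variable {V E : Type*} (G : SurfaceGraph V E)

/-- One step of face traversal. A state is a dart with a sense of rotation `±1` at its tail.
After traversing the dart, the sense is switched if the edge has signature `-1`, and the walk
continues with the dart next to the reversed one in the resulting sense. -/
def faceStep (x : (E × Bool) × ℤˣ) : (E × Bool) × ℤˣ :=
  let s := x.2 * G.sign x.1.1
  (if s = 1 then G.rot (Multigraph.rev x.1) else G.rot.symm (Multigraph.rev x.1), s)

/-- The facial paths: paths of consecutive darts in a face traversal. -/
def facialPaths : Set (List (E × Bool)) :=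
  {p | G.IsPath p ∧ ∃ x, p = (List.range p.length).map fun i => (G.faceStep^[i] x).1}

/-- The facial Thue choice index of a graph embedded on a surface. -/
noncomputable def facialThueChoiceIndex : ℕ∞ := facialChoiceIndex G.facialPaths

end SurfaceGraph

/-! ### Counting colorings without repetitions along trails -/

/-! The argument is a Rosenfeld-style count. Edges are colored one at a time, and the number of good
colorings of the colored set `S` is shown never to decrease. It even at least triples when the new
edge `e` keeps an uncolored facial neighbor (`card_colorings_insert`). With lists of size 10 there
are at least 10 times as many extensions to `e` as good colorings of `S`. A bad extension repeats
along a trail of some length `2(m+1)` through `e`. A trail is fixed by its length, the side of `e`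
it uses (two sides) and the position of `e` on it, so there are at most `4(m+1)` of them. On each
one, the half containing `e` is dictated by the other half. Uncoloring its `m` other edges outward
from `e` always removes a neighbor of an uncolored edge, so by induction at most a fraction `3^{-m}`
of the good colorings of `S` is lost to that trail. Since `∑ 4(m+1)/3^m = 9`, a factor `10 - 9 = 1`
survives. An uncolored neighbor of `e` blocks one side, which lowers the sum to 6 and leaves a
factor `4 ≥ 3`. The count needs only a bi-unique successor relation and two representatives per edge
(`Represents`). These are supplied by face traversal on surfaces (`represents_faceStep`) and by
angles at vertices in the plane (`represents_followsOn`). -/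

namespace TrailColoring

variable {E D : Type*}

/-- A chain of the relation `R` whose labels are distinct. -/
def IsTrail (lab : D → E) (R : D → D → Prop) (p : List D) : Prop :=
  p.IsChain R ∧ (p.map lab).Nodup

/-- No trail with labels in `S` is colored repetitively. -/
def GoodOn (lab : D → E) (R : D → D → Prop) (S : Finset E) (c : E → ℕ) : Prop :=
  ∀ p, IsTrail lab R p → (∀ d ∈ p, lab d ∈ S) → ¬ IsRepetition (p.map fun d => c (lab d))

/-- The edge `f` follows or precedes a representative of `e`. -/
def Adjacent (lab : D → E) (R : D → D → Prop) (T : E → Bool → D) (e f : E) : Prop :=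
  ∃ b d, lab d = f ∧ (R (T e b) d ∨ R d (T e b))

/-- `T e false` and `T e true` represent all passages of trails through `e`: every trail through
`e` contains one of them, possibly after reversal. -/
structure Represents (lab : D → E) (R : D → D → Prop) (T : E → Bool → D) : Prop where
  lab_eq : ∀ e b, lab (T e b) = e
  rightUnique : ∀ d d₁ d₂, R d d₁ → R d d₂ → d₁ = d₂
  leftUnique : ∀ d₁ d₂ d, R d₁ d → R d₂ d → d₁ = d₂
  adjacent_left : ∀ d d', R d d' → Adjacent lab R T (lab d) (lab d')
  adjacent_right : ∀ d d', R d d' → Adjacent lab R T (lab d') (lab d)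
  exists_mem : ∀ p, IsTrail lab R p → ∀ d ∈ p, ∃ q, IsTrail lab R q ∧
    (q.map lab = p.map lab ∨ q.map lab = (p.map lab).reverse) ∧ ∃ b, T (lab d) b ∈ q

theorem isRepetition_reverse {C : Type*} {w : List C} (h : IsRepetition w) :
    IsRepetition w.reverse := by
  obtain ⟨u, hu, rfl⟩ := h
  exact ⟨u.reverse, by simpa using hu, by simp⟩

theorem GoodOn.mono {lab : D → E} {R : D → D → Prop} {S S' : Finset E} {c c' : E → ℕ}
    (h : GoodOn lab R S' c) (hS : S ⊆ S') (hc : ∀ e ∈ S, c' e = c e) : GoodOn lab R S c' := by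
  intro p hp hpS hrep
  refine h p hp (fun d hd => hS (hpS d hd)) ?_
  rwa [List.map_congr_left (fun d hd => hc _ (hpS d hd))] at hrep

/-- A chain of a bi-unique relation is determined by its length and one of its entries. -/
theorem isChain_ext {R : D → D → Prop} (hr : ∀ d d₁ d₂, R d d₁ → R d d₂ → d₁ = d₂)
    (hl : ∀ d₁ d₂ d, R d₁ d → R d₂ d → d₁ = d₂) {p q : List D} (hp : p.IsChain R)
    (hq : q.IsChain R) (hlen : p.length = q.length) {i : ℕ} {t : D} (hpi : p[i]? = some t)
    (hqi : q[i]? = some t) : p = q := by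
  rw [List.isChain_iff_getElem] at hp hq
  obtain ⟨hi, hpi⟩ := List.getElem?_eq_some_iff.1 hpi
  obtain ⟨hi', hqi⟩ := List.getElem?_eq_some_iff.1 hqi
  have up : ∀ k, ∀ (h : i + k < p.length), p[i + k] = q[i + k] := by
    intro k
    induction k with
    | zero => intro h; simp [hpi, hqi]
    | succ k ih =>
      intro h
      have h1 := hp (i + k) (by omega)
      have h2 := hq (i + k) (by omega)
      rw [← ih (by omega)] at h2
      exact hr _ _ _ h1 h2
  have down : ∀ k, ∀ j (h : j < p.length), j + k = i → p[j] = q[j] := by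
    intro k
    induction k with
    | zero => intro j h hj; simp only [Nat.add_zero] at hj; subst hj; rw [hpi, hqi]
    | succ k ih =>
      intro j h hj
      have h1 := hp j (by omega)
      have h2 := hq j (by omega)
      rw [← ih (j + 1) (by omega) (by omega)] at h2
      exact hl _ _ _ h1 h2
  refine List.ext_getElem hlen fun j h1 h2 => ?_
  rcases le_total i j with h | h
  · obtain ⟨k, rfl⟩ := Nat.exists_eq_add_of_le h
    exact up k h1
  · exact down (i - j) j h1 (by omega)

/-! ### Restricting, extending and uncoloring partial colorings. -/

section Counting

variable [Fintype E] [DecidableEq E] (lab : D → E) (R : D → D → Prop) (L : E → Finset ℕ)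

open Classical in
/-- The colorings of `S` from the lists, with color `0` outside of `S`, without repetition. -/
noncomputable def colorings (S : Finset E) : Finset (E → ℕ) :=
  (Fintype.piFinset fun e => if e ∈ S then L e else {0}).filter (GoodOn lab R S)

open Classical in
/-- The colorings of `insert e S` from the lists whose restriction to `S` has no repetition. -/
noncomputable def extensions (S : Finset E) (e : E) : Finset (E → ℕ) :=
  (Fintype.piFinset fun x => if x ∈ insert e S then L x else {0}).filter (GoodOn lab R S)

variable {lab R L}

theorem mem_piFinset_ite {S : Finset E} {c : E → ℕ} :
    c ∈ Fintype.piFinset (fun e => if e ∈ S then L e else {0}) ↔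
      (∀ e ∈ S, c e ∈ L e) ∧ ∀ e ∉ S, c e = 0 := by
  rw [Fintype.mem_piFinset]
  refine ⟨fun h => ⟨fun e he => ?_, fun e he => ?_⟩, fun h e => ?_⟩
  · simpa only [if_pos he] using h e
  · simpa only [if_neg he, Finset.mem_singleton] using h e
  · by_cases he : e ∈ S
    · simpa only [if_pos he] using h.1 e he
    · simpa only [if_neg he, Finset.mem_singleton] using h.2 e he

theorem mem_colorings {S : Finset E} {c : E → ℕ} : c ∈ colorings lab R L S ↔
    (∀ e ∈ S, c e ∈ L e) ∧ (∀ e ∉ S, c e = 0) ∧ GoodOn lab R S c := by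
  classical
  rw [← and_assoc, ← mem_piFinset_ite, ← Finset.mem_filter]
  unfold colorings
  convert Iff.rfl

theorem mem_extensions {S : Finset E} {e : E} {c : E → ℕ} : c ∈ extensions lab R L S e ↔
    (∀ x ∈ insert e S, c x ∈ L x) ∧ (∀ x ∉ insert e S, c x = 0) ∧ GoodOn lab R S c := by
  classical
  rw [← and_assoc, ← mem_piFinset_ite, ← Finset.mem_filter]
  unfold extensions
  convert Iff.rfl

theorem restrict_mem_colorings {S S' : Finset E} {c : E → ℕ} (hS : S ⊆ S')
    (hL : ∀ e ∈ S, c e ∈ L e) (hc : GoodOn lab R S' c) :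
    (fun e => if e ∈ S then c e else 0) ∈ colorings lab R L S := by
  refine mem_colorings.2 ⟨fun e he => by simpa [he] using hL e he, fun e he => by simp [he],
    hc.mono hS fun e he => by simp [he]⟩

/-- Trails inside `S` do not see `e`, so its color is free. -/
theorem card_extensions {k : ℕ} (hL : ∀ e, k ≤ (L e).card) {S : Finset E} {e : E} (he : e ∉ S) :
    k * (colorings lab R L S).card ≤ (extensions lab R L S e).card := by
  calc k * (colorings lab R L S).card ≤ (L e ×ˢ colorings lab R L S).card := by
        rw [Finset.card_product]; exact Nat.mul_le_mul_right _ (hL e)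
    _ ≤ _ := by
        refine Finset.card_le_card_of_injOn (fun x => Function.update x.2 e x.1) ?_ ?_
        · rintro ⟨a, c⟩ h
          obtain ⟨ha, hc⟩ := Finset.mem_product.1 h
          obtain ⟨h1, h2, h3⟩ := mem_colorings.1 hc
          refine mem_extensions.2 ⟨fun x hx => ?_, fun x hx => ?_, h3.mono subset_rfl ?_⟩
          · by_cases hxe : x = e
            · subst hxe; simpa using ha
            · simpa [hxe] using h1 x ((Finset.mem_insert.1 hx).resolve_left hxe)
          · rw [Finset.mem_insert, not_or] at hx
            simpa [hx.1] using h2 x hx.2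
          · intro x hx
            have : x ≠ e := fun h => he (h ▸ hx)
            simp [this]
        · rintro ⟨a, c⟩ h ⟨a', c'⟩ h' heq
          have hc := mem_colorings.1 (Finset.mem_product.1 h).2
          have hc' := mem_colorings.1 (Finset.mem_product.1 h').2
          have ha : a = a' := by simpa using congrFun heq e
          refine Prod.ext ha (funext fun x => ?_)
          by_cases hxe : x = e
          · subst hxe; rw [hc.2.1 _ he, hc'.2.1 _ he]
          · simpa [hxe] using congrFun heq x

/-- If the labels of `h` are colored like those of `o`, which are not in `h`, then the
coloring is determined by its restriction to the complement of `h`. -/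
theorem card_le_card_colorings_sdiff {S : Finset E} {e : E} {A : Finset (E → ℕ)}
    (hA : A ⊆ extensions lab R L S e) {h o : List D} (heh : e ∈ h.map lab)
    (hoh : ∀ d ∈ o, lab d ∉ h.map lab)
    (hrep : ∀ c ∈ A, (h.map fun d => c (lab d)) = o.map fun d => c (lab d)) :
    A.card ≤ (colorings lab R L (S \ (h.map lab).toFinset)).card := by
  refine Finset.card_le_card_of_injOn
    (fun c x => if x ∈ S \ (h.map lab).toFinset then c x else 0) ?_ ?_
  · intro c hc
    obtain ⟨h1, h2, h3⟩ := mem_extensions.1 (hA hc)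
    exact restrict_mem_colorings Finset.sdiff_subset
      (fun x hx => h1 x (Finset.mem_insert_of_mem (Finset.mem_sdiff.1 hx).1)) h3
  · intro c hc c' hc' heq
    obtain ⟨-, h2, -⟩ := mem_extensions.1 (hA hc)
    obtain ⟨-, h2', -⟩ := mem_extensions.1 (hA hc')
    -- Off `h` the two colorings agree: by assumption on the rest of `S`, and by the default color 0
    -- elsewhere. The repetition then copies the agreement from `o` to `h`.
    have key : ∀ x ∉ h.map lab, c x = c' x := by
      intro x hx
      by_cases hxS : x ∈ insert e S
      · have hxe : x ≠ e := fun h' => hx (h' ▸ heh)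
        have hxS := (Finset.mem_insert.1 hxS).resolve_left hxe
        have := congrFun heq x
        have hm : x ∈ S \ (h.map lab).toFinset :=
          Finset.mem_sdiff.2 ⟨hxS, by rwa [List.mem_toFinset]⟩
        simpa only [if_pos hm] using this
      · rw [h2 x hxS, h2' x hxS]
    funext x
    by_cases hx : x ∈ h.map lab
    · have ho : (o.map fun d => c (lab d)) = o.map fun d => c' (lab d) :=
        List.map_congr_left fun d hd => key _ (hoh d hd)
      have : (h.map fun d => c (lab d)) = h.map fun d => c' (lab d) := by
        rw [hrep c hc, hrep c' hc', ho]
      obtain ⟨d, hd, rfl⟩ := List.mem_map.1 hx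
      exact List.map_inj_left.1 this d hd
    · exact key x hx

/-- Uncoloring a trail outward from an uncolored edge loses a factor `3` at each step. -/
theorem pow_mul_card_colorings_sdiff_le {T : E → Bool → D} (hT : Represents lab R T)
    {S : Finset E}
    (ih : ∀ S' : Finset E, S'.card < S.card → ∀ x f, x ∉ S' → f ∉ insert x S' →
      Adjacent lab R T x f →
      3 * (colorings lab R L S').card ≤ (colorings lab R L (insert x S')).card)
    {t : D} (ht : lab t ∉ S) (l₁ l₂ : List D) (hp : IsTrail lab R (l₁ ++ t :: l₂))
    (hS : ∀ d ∈ l₁ ++ l₂, lab d ∈ S) :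
    3 ^ (l₁.length + l₂.length) *
      (colorings lab R L (S \ ((l₁ ++ t :: l₂).map lab).toFinset)).card ≤
        (colorings lab R L S).card := by
  have step : ∀ (x y : D) (q : List D), y ∈ q → lab x ∈ S → lab x ∉ q.map lab →
      Adjacent lab R T (lab x) (lab y) →
      3 * (colorings lab R L (S \ (insert (lab x) (q.map lab).toFinset))).card ≤
        (colorings lab R L (S \ (q.map lab).toFinset)).card := by
    intro x y q hy hx hxq hxy
    have hins : insert (lab x) (S \ (insert (lab x) (q.map lab).toFinset)) =
        S \ (q.map lab).toFinset := by
      ext z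
      simp only [Finset.mem_insert, Finset.mem_sdiff, List.mem_toFinset]
      by_cases hz : z = lab x
      · subst hz; simp only [hx, hxq, true_or, not_false_eq_true, and_self]
      · simp only [hz, false_or]
    rw [← hins]
    -- The edge of `y` is already uncolored, so it serves as the uncolored neighbor when `x` is
    -- colored back.
    refine ih _ (Finset.card_lt_card ?_) _ (lab y) (by simp) ?_ hxy
    · refine Finset.ssubset_iff_of_subset Finset.sdiff_subset |>.2 ⟨lab x, hx, by simp⟩
    · rw [hins]
      have := List.mem_map_of_mem (f := lab) hy
      simp only [Finset.mem_sdiff, List.mem_toFinset, not_and, not_not]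
      exact fun _ => this
  -- The peeled entry is always at an end of the trail, hence next to the part uncolored before it:
  -- left ends here, right ends inside the base case.
  induction l₁ with
  | nil =>
    simp only [List.nil_append] at hp hS ⊢
    induction l₂ using List.reverseRecOn with
    | nil =>
      have : S \ ([t].map lab).toFinset = S := by
        exact Finset.sdiff_eq_self_of_disjoint (by simpa using ht)
      rw [this]; simp
    | append_singleton l x ihl =>
      have hp' : IsTrail lab R (t :: l) := by
        refine ⟨List.IsChain.left_of_append (l₂ := [x]) (by simpa using hp.1), ?_⟩
        have := hp.2
        rw [← List.cons_append, List.map_append] at this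
        exact this.of_append_left
      have h1 := ihl hp' fun d hd => hS d (by simp [hd])
      have hR : R ((t :: l).getLast (by simp)) x := by
        have := hp.1
        rw [← List.cons_append, List.isChain_append] at this
        exact this.2.2 _ (List.getLast_mem_getLast? _) _ (by simp)
      have hx : lab x ∉ (t :: l).map lab := by
        have := hp.2
        rw [← List.cons_append, List.map_append, List.nodup_append] at this
        intro hx
        exact this.2.2 _ hx _ (by simp) rfl
      have h2 := step x _ (t :: l) (List.getLast_mem (by simp)) (hS x (by simp)) hx
        (hT.adjacent_right _ _ hR)
      have hset : ((t :: (l ++ [x])).map lab).toFinset =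
          insert (lab x) ((t :: l).map lab).toFinset := by
        rw [← List.cons_append, List.map_append, List.toFinset_append, Finset.union_comm]
        rfl
      rw [hset]
      simp only [List.length_nil, zero_add, List.length_append, List.length_singleton] at h1 ⊢
      rw [pow_succ, mul_assoc]
      exact (Nat.mul_le_mul_left _ h2).trans h1
  | cons x l ihl =>
    have hp' : IsTrail lab R (l ++ t :: l₂) := ⟨hp.1.tail, (List.nodup_cons.1 hp.2).2⟩
    have h1 := ihl hp' fun d hd => hS d (by simp at hd ⊢; tauto)
    have hne : l ++ t :: l₂ ≠ [] := by simp
    have hR : R x ((l ++ t :: l₂).head hne) := by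
      have := hp.1
      rw [List.cons_append, List.isChain_cons] at this
      exact this.1 _ (List.head_mem_head? _)
    have h2 := step x _ (l ++ t :: l₂) (List.head_mem hne) (hS x (by simp))
      (List.nodup_cons.1 hp.2).1 (hT.adjacent_left _ _ hR)
    have hset : ((x :: l ++ t :: l₂).map lab).toFinset =
        insert (lab x) ((l ++ t :: l₂).map lab).toFinset := by
      rw [List.cons_append, List.map_cons, List.toFinset_cons]
    rw [hset]
    have : (x :: l).length + l₂.length = (l.length + l₂.length) + 1 := by simp; omega
    rw [this, pow_succ, mul_assoc]
    exact (Nat.mul_le_mul_left _ h2).trans h1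

end Counting

end TrailColoring

namespace TrailColoring

variable {E D : Type*}

theorem take_eq_drop_of_isRepetition {C : Type*} {w : List C} {m : ℕ} (hw : IsRepetition w)
    (hlen : w.length = 2 * m) : w.take m = w.drop m := by
  obtain ⟨u, -, rfl⟩ := hw
  have : u.length = m := by simp at hlen; omega
  subst this
  simp

/-! ### Repetitions through the newly colored edge, and the main induction. -/

section Counting

variable [Fintype E] [DecidableEq E] (lab : D → E) (R : D → D → Prop) (L : E → Finset ℕ)

open Classical in
/-- The colorings in `extensions lab R L S e` that have a repetition along a trail of length
`2 * (m + 1)` with entry `t` at position `i`. -/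
noncomputable def repetitive (S : Finset E) (e : E) (m : ℕ) (t : D) (i : ℕ) : Finset (E → ℕ) :=
  (extensions lab R L S e).filter fun c => ∃ p, IsTrail lab R p ∧
    (∀ d ∈ p, lab d ∈ insert e S) ∧ p.length = 2 * (m + 1) ∧ p[i]? = some t ∧
    IsRepetition (p.map fun d => c (lab d))

variable {lab R L}

theorem mem_repetitive {S : Finset E} {e : E} {m : ℕ} {t : D} {i : ℕ} {c : E → ℕ} :
    c ∈ repetitive lab R L S e m t i ↔ c ∈ extensions lab R L S e ∧ ∃ p, IsTrail lab R p ∧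
    (∀ d ∈ p, lab d ∈ insert e S) ∧ p.length = 2 * (m + 1) ∧ p[i]? = some t ∧
    IsRepetition (p.map fun d => c (lab d)) := by
  classical
  unfold repetitive
  rw [Finset.mem_filter]

/-- The half of the trail containing `e` is determined by the other half, so these colorings inject
into those of `S` minus that half. It has `m` edges besides `e`, each worth a factor 3. -/
theorem pow_mul_card_repetitive_le {T : E → Bool → D} (hT : Represents lab R T)
    {S : Finset E} {e : E} (he : e ∉ S)
    (ih : ∀ S' : Finset E, S'.card < S.card → ∀ x f, x ∉ S' → f ∉ insert x S' →
      Adjacent lab R T x f →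
      3 * (colorings lab R L S').card ≤ (colorings lab R L (insert x S')).card)
    (m i : ℕ) (b : Bool) :
    3 ^ m * (repetitive lab R L S e m (T e b) i).card ≤ (colorings lab R L S).card := by
  rcases (repetitive lab R L S e m (T e b) i).eq_empty_or_nonempty with h0 | ⟨c₀, hc₀⟩
  · simp [h0]
  obtain ⟨-, p, hp, hpS, hlen, hpi, -⟩ := mem_repetitive.1 hc₀
  have hte : lab (T e b) = e := hT.lab_eq e b
  have hrep : ∀ c ∈ repetitive lab R L S e m (T e b) i,
      ((p.take (m + 1)).map fun d => c (lab d)) = (p.drop (m + 1)).map fun d => c (lab d) := by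
    intro c hc
    obtain ⟨-, q, hq, -, hqlen, hqi, hqrep⟩ := mem_repetitive.1 hc
    -- Length and the entry at position `i` pin down the trail, so one trail serves for all
    -- colorings in the set.
    obtain rfl : p = q :=
      isChain_ext hT.rightUnique hT.leftUnique hp.1 hq.1 (hlen.trans hqlen.symm) hpi hqi
    have := take_eq_drop_of_isRepetition (m := m + 1) hqrep (by simpa using hlen)
    simpa only [List.map_take, List.map_drop] using this
  have hsub : repetitive lab R L S e m (T e b) i ⊆ extensions lab R L S e :=
    fun c hc => (mem_repetitive.1 hc).1
  have key : ∀ h o : List D, IsTrail lab R h → h.length = m + 1 → T e b ∈ h →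
      (∀ d ∈ h, lab d ∈ insert e S) → (∀ d ∈ o, lab d ∉ h.map lab) →
      (∀ c ∈ repetitive lab R L S e m (T e b) i,
        (h.map fun d => c (lab d)) = o.map fun d => c (lab d)) →
      3 ^ m * (repetitive lab R L S e m (T e b) i).card ≤ (colorings lab R L S).card := by
    intro h o hh hhlen hth hhS hoh hho
    have h1 := card_le_card_colorings_sdiff hsub
      (List.mem_map.2 ⟨_, hth, hte⟩) hoh hho
    obtain ⟨l₁, l₂, rfl⟩ := List.append_of_mem hth
    have hm : l₁.length + l₂.length = m := by simp at hhlen; omega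
    have h2 := pow_mul_card_colorings_sdiff_le hT ih (t := T e b) (by rwa [hte]) l₁ l₂ hh ?_
    · rw [hm] at h2
      exact (Nat.mul_le_mul_left _ h1).trans h2
    · intro d hd
      have hd' : d ∈ l₁ ++ T e b :: l₂ := by simp at hd ⊢; tauto
      refine (Finset.mem_insert.1 (hhS d hd')).resolve_left fun hde => ?_
      have hnd := hh.2
      rw [List.map_append, List.map_cons, List.nodup_middle, ← List.map_append,
        List.nodup_cons, hte] at hnd
      exact hnd.1 (List.mem_map.2 ⟨d, hd, hde⟩)
  have htp : T e b ∈ p.take (m + 1) ++ p.drop (m + 1) := by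
    rw [List.take_append_drop]; exact List.mem_of_getElem? hpi
  have hnd := hp.2
  have hch := hp.1
  rw [← List.take_append_drop (m + 1) p] at hnd hch
  rw [List.map_append, List.nodup_append] at hnd
  rcases List.mem_append.1 htp with ht | ht
  · refine key _ (p.drop (m + 1)) ⟨hch.left_of_append, hnd.1⟩ (by simp; omega) ht
      (fun d hd => hpS d (List.mem_of_mem_take hd)) (fun d hd hd' => ?_) hrep
    exact hnd.2.2 _ hd' _ (List.mem_map_of_mem hd) rfl
  · refine key _ (p.take (m + 1)) ⟨hch.right_of_append, hnd.2.1⟩ (by simp; omega) ht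
      (fun d hd => hpS d (List.mem_of_mem_drop hd)) (fun d hd hd' => ?_)
      (fun c hc => (hrep c hc).symm)
    exact hnd.2.2 _ (List.mem_map_of_mem hd) _ hd' rfl

/-- Next to an uncolored edge, trails can only start or only end at a representative. -/
theorem exists_repetitive_eq_empty {T : E → Bool → D} (hT : Represents lab R T)
    {S : Finset E} {e f : E} (hf : f ∉ insert e S) (hef : Adjacent lab R T e f) :
    ∃ b, ∀ m, ∃ i₀, ∀ i ≠ i₀, repetitive lab R L S e m (T e b) i = ∅ := by
  obtain ⟨b, d, rfl, hd⟩ := hef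
  refine ⟨b, fun m => ?_⟩
  rcases hd with hd | hd
  -- The only possible successor of the representative is uncolored, so the trail must end there, at
  -- its last index `2 * m + 1`.
  · refine ⟨2 * m + 1, fun i hi => Finset.eq_empty_of_forall_notMem fun c hc => ?_⟩
    obtain ⟨-, p, hp, hpS, hlen, hpi, -⟩ := mem_repetitive.1 hc
    obtain ⟨hi', hpi⟩ := List.getElem?_eq_some_iff.1 hpi
    have hlt : i + 1 < p.length := by omega
    have := List.isChain_iff_getElem.1 hp.1 i hlt
    rw [hpi] at this
    have hdd := hT.rightUnique _ _ _ hd this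
    exact hf (hdd ▸ hpS _ (List.getElem_mem hlt))
  · refine ⟨0, fun i hi => Finset.eq_empty_of_forall_notMem fun c hc => ?_⟩
    obtain ⟨-, p, hp, hpS, hlen, hpi, -⟩ := mem_repetitive.1 hc
    obtain ⟨hi', hpi⟩ := List.getElem?_eq_some_iff.1 hpi
    obtain ⟨j, rfl⟩ := Nat.exists_eq_succ_of_ne_zero hi
    have := List.isChain_iff_getElem.1 hp.1 j hi'
    simp only [Nat.succ_eq_add_one] at hpi
    rw [hpi] at this
    have hdd := hT.leftUnique _ _ _ hd this
    exact hf (hdd ▸ hpS _ (List.getElem_mem (by omega)))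

/-- Union bound: a repetition absent before `e` was colored uses `e`, and after a possible reversal
it passes through a representative of `e`. -/
theorem card_extensions_le {T : E → Bool → D} (hT : Represents lab R T)
    (S : Finset E) (e : E) :
    (extensions lab R L S e).card ≤ (colorings lab R L (insert e S)).card +
      ∑ m ∈ Finset.range (Fintype.card E), ∑ b : Bool, ∑ i ∈ Finset.range (2 * (m + 1)),
        (repetitive lab R L S e m (T e b) i).card := by
  have hsub : extensions lab R L S e ⊆ colorings lab R L (insert e S) ∪
      (Finset.range (Fintype.card E)).biUnion fun m => Finset.univ.biUnion fun b =>
        (Finset.range (2 * (m + 1))).biUnion fun i => repetitive lab R L S e m (T e b) i := by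
    intro c hc
    obtain ⟨h1, h2, h3⟩ := mem_extensions.1 hc
    rw [Finset.mem_union]
    by_cases hgood : GoodOn lab R (insert e S) c
    · exact Or.inl (mem_colorings.2 ⟨h1, h2, hgood⟩)
    right
    simp only [GoodOn, not_forall, not_not] at hgood
    obtain ⟨p, hp, hpS, hrep⟩ := hgood
    obtain ⟨d, hd, hde⟩ : ∃ d ∈ p, lab d = e := by
      by_contra! hne
      exact h3 p hp (fun d hd => (Finset.mem_insert.1 (hpS d hd)).resolve_left (hne d hd)) hrep
    obtain ⟨q, hq, hqp, b, hb⟩ := hT.exists_mem p hp d hd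
    rw [hde] at hb
    have hqS : ∀ x ∈ q, lab x ∈ insert e S := by
      intro x hx
      have hx' : lab x ∈ p.map lab := by
        rcases hqp with h | h
        · exact h ▸ List.mem_map_of_mem hx
        · exact List.mem_reverse.1 (h ▸ List.mem_map_of_mem hx)
      obtain ⟨y, hy, hyx⟩ := List.mem_map.1 hx'
      exact hyx ▸ hpS y hy
    have hqrep : IsRepetition (q.map fun x => c (lab x)) := by
      have hmap : ∀ l : List D, (l.map fun x => c (lab x)) = (l.map lab).map c := by simp
      rw [hmap] at hrep ⊢
      rcases hqp with h | h
      · rwa [h]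
      · rw [h, List.map_reverse]; exact isRepetition_reverse hrep
    -- Trails do not repeat labels, so only finitely many lengths matter.
    have hcard : q.length ≤ Fintype.card E := by
      simpa using hq.2.length_le_card
    have ⟨u, hu, hqu⟩ := hqrep
    have hlen : q.length = u.length + u.length := by
      simpa using congrArg List.length hqu
    have hu0 := List.length_pos_iff.2 hu
    obtain ⟨i, hi, hqi⟩ := List.getElem_of_mem hb
    simp only [Finset.mem_biUnion, Finset.mem_range, Finset.mem_univ, true_and]
    refine ⟨u.length - 1, by omega, b, i, by omega, mem_repetitive.2 ⟨hc, q, hq, hqS, by omega,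
      List.getElem?_eq_some_iff.2 ⟨hi, hqi⟩, hqrep⟩⟩
  refine (Finset.card_le_card hsub).trans ((Finset.card_union_le _ _).trans ?_)
  refine Nat.add_le_add_left (Finset.card_biUnion_le.trans (Finset.sum_le_sum fun m _ => ?_)) _
  exact Finset.card_biUnion_le.trans (Finset.sum_le_sum fun b _ => Finset.card_biUnion_le)

/-- Two sides with `2(m+1)` positions each; the full series is `4/(1 - 1/3)^2 = 9`. -/
theorem sum_four_mul_div_pow_le (n : ℕ) :
    ∑ m ∈ Finset.range n, (4 * (m + 1) : ℝ) / 3 ^ m ≤ 9 := by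
  have : ∑ m ∈ Finset.range n, (4 * (m + 1) : ℝ) / 3 ^ m = 9 - (6 * n + 9) / 3 ^ n := by
    induction n with
    | zero => simp
    | succ n ih => rw [Finset.sum_range_succ, ih]; push_cast; field_simp; ring
  rw [this]
  have : (0 : ℝ) ≤ (6 * n + 9) / 3 ^ n := by positivity
  linarith

/-- One free side with `2(m+1)` positions and one blocked side with a single position; the full
series is `9/2 + 3/2 = 6`. -/
theorem sum_two_mul_add_div_pow_le (n : ℕ) :
    ∑ m ∈ Finset.range n, (2 * m + 3 : ℝ) / 3 ^ m ≤ 6 := by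
  have : ∑ m ∈ Finset.range n, (2 * m + 3 : ℝ) / 3 ^ m = 6 - (3 * n + 6) / 3 ^ n := by
    induction n with
    | zero => simp
    | succ n ih => rw [Finset.sum_range_succ, ih]; push_cast; field_simp; ring
  rw [this]
  have : (0 : ℝ) ≤ (3 * n + 6) / 3 ^ n := by positivity
  linarith

theorem sum_le_mul_of_pow_mul_le {n s A : ℕ} {W w : ℕ → ℕ}
    (hW : ∀ m, 3 ^ m * W m ≤ w m * A)
    (hw : ∑ m ∈ Finset.range n, (w m : ℝ) / 3 ^ m ≤ s) :
    ∑ m ∈ Finset.range n, W m ≤ s * A := by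
  have : (∑ m ∈ Finset.range n, (W m : ℝ)) ≤ s * A := by
    calc (∑ m ∈ Finset.range n, (W m : ℝ))
        ≤ ∑ m ∈ Finset.range n, (w m : ℝ) / 3 ^ m * A := by
          refine Finset.sum_le_sum fun m _ => ?_
          rw [div_mul_eq_mul_div, le_div_iff₀ (by positivity), mul_comm]
          exact_mod_cast hW m
      _ = (∑ m ∈ Finset.range n, (w m : ℝ) / 3 ^ m) * A := by rw [Finset.sum_mul]
      _ ≤ s * A := by gcongr
  exact_mod_cast this

/-- Coloring one more edge does not decrease the number of good colorings, and triples it if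
an adjacent edge remains uncolored. -/
theorem card_colorings_insert {T : E → Bool → D} (hT : Represents lab R T)
    (hL : ∀ e, 10 ≤ (L e).card) (S : Finset E) : ∀ e ∉ S,
    (colorings lab R L S).card ≤ (colorings lab R L (insert e S)).card ∧
    ∀ f ∉ insert e S, Adjacent lab R T e f →
      3 * (colorings lab R L S).card ≤ (colorings lab R L (insert e S)).card := by
  induction hn : S.card using Nat.strong_induction_on generalizing S with
  | _ n ih =>
  intro e he
  subst hn
  have ih' : ∀ S' : Finset E, S'.card < S.card → ∀ x f, x ∉ S' → f ∉ insert x S' →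
      Adjacent lab R T x f →
      3 * (colorings lab R L S').card ≤ (colorings lab R L (insert x S')).card :=
    fun S' hS' x f hx hf hxf => (ih _ hS' S' rfl x hx).2 f hf hxf
  have hpow := fun m i b => pow_mul_card_repetitive_le hT he ih' m i b
  have hext := card_extensions (lab := lab) (R := R) hL he
  have hle := card_extensions_le (L := L) hT S e
  have side : ∀ b m, 3 ^ m * ∑ i ∈ Finset.range (2 * (m + 1)),
      (repetitive lab R L S e m (T e b) i).card ≤
        (2 * (m + 1)) * (colorings lab R L S).card := by
    intro b m
    rw [Finset.mul_sum]
    refine (Finset.sum_le_card_nsmul _ _ _ fun i _ => hpow m i b).trans ?_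
    simp
  refine ⟨?_, fun f hf hef => ?_⟩
  · have : _ ≤ 9 * (colorings lab R L S).card :=
      sum_le_mul_of_pow_mul_le (n := Fintype.card E) (w := fun m => 4 * (m + 1))
        (W := fun m => ∑ b : Bool, ∑ i ∈ Finset.range (2 * (m + 1)),
          (repetitive lab R L S e m (T e b) i).card) (fun m => ?_)
        (by push_cast; exact sum_four_mul_div_pow_le _)
    · omega
    · rw [Fintype.sum_bool, mul_add]
      have h1 := side true m
      have h2 := side false m
      linarith
  · obtain ⟨b, hb⟩ := exists_repetitive_eq_empty (L := L) hT hf hef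
    have hside : ∀ m, 3 ^ m * ∑ i ∈ Finset.range (2 * (m + 1)),
        (repetitive lab R L S e m (T e b) i).card ≤ (colorings lab R L S).card := by
      intro m
      obtain ⟨i₀, hi₀⟩ := hb m
      refine (Nat.mul_le_mul_left _ ?_).trans (hpow m i₀ b)
      calc _ ≤ ∑ i ∈ Finset.range (2 * (m + 1)),
            if i = i₀ then (repetitive lab R L S e m (T e b) i₀).card else 0 := by
            refine Finset.sum_le_sum fun i _ => ?_
            by_cases hi : i = i₀
            · subst hi; simp
            · simp [hi, hi₀ i hi]
        _ ≤ _ := by rw [Finset.sum_ite_eq']; split_ifs <;> simp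
    have : _ ≤ 6 * (colorings lab R L S).card :=
      sum_le_mul_of_pow_mul_le (n := Fintype.card E) (w := fun m => 2 * m + 3)
        (W := fun m => ∑ b : Bool, ∑ i ∈ Finset.range (2 * (m + 1)),
          (repetitive lab R L S e m (T e b) i).card) (fun m => ?_)
        (by push_cast; exact sum_two_mul_add_div_pow_le _)
    · omega
    · rw [Fintype.sum_bool, mul_add]
      have h1 := hside m
      have h2 := side (!b) m
      cases b <;> simp only [Bool.not_true, Bool.not_false] at h2 <;> linarith

theorem colorings_nonempty {T : E → Bool → D} (hT : Represents lab R T)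
    (hL : ∀ e, 10 ≤ (L e).card) (S : Finset E) : (colorings lab R L S).Nonempty := by
  induction S using Finset.induction_on with
  | empty =>
    -- With no colored edge only the empty trail remains, and repetitions are nonempty.
    refine ⟨0, mem_colorings.2 ⟨by simp, by simp, fun p _ hp hrep => ?_⟩⟩
    obtain ⟨u, hu, hpu⟩ := hrep
    cases p with
    | nil => simp_all
    | cons d l => exact absurd (hp d (by simp)) (by simp)
  | insert e S he ih =>
    exact Finset.card_pos.1 (ih.card_pos.trans_le (card_colorings_insert hT hL S e he).1)

end Counting

/-- Colors can be chosen from lists of size `10` so that no trail is colored repetitively. -/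
theorem exists_coloring [Finite E] {lab : D → E} {R : D → D → Prop} {T : E → Bool → D}
    (hT : Represents lab R T) {L : E → Finset ℕ} (hL : ∀ e, 10 ≤ (L e).card) :
    ∃ c : E → ℕ, (∀ e, c e ∈ L e) ∧
      ∀ p, IsTrail lab R p → ¬ IsRepetition (p.map fun d => c (lab d)) := by
  classical
  have := Fintype.ofFinite E
  obtain ⟨c, hc⟩ := colorings_nonempty hT hL Finset.univ
  obtain ⟨h1, -, h3⟩ := mem_colorings.1 hc
  exact ⟨c, fun e => h1 e (Finset.mem_univ e), fun p hp => h3 p hp fun d _ => Finset.mem_univ _⟩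

end TrailColoring

/-! ### Paths and the choice index -/

namespace Multigraph

variable {V E : Type*} {G : Multigraph V E}

theorem rev_rev (d : E × Bool) : rev (rev d) = d := by simp [rev]

theorem eq_or_eq_rev {d d' : E × Bool} (h : d.1 = d'.1) : d = d' ∨ d' = rev d := by
  obtain ⟨e, b⟩ := d
  obtain ⟨e', b'⟩ := d'
  obtain rfl : e = e' := h
  cases b <;> cases b' <;> simp [rev]

theorem length_support {p : List (E × Bool)} (hp : p ≠ []) :
    (G.support p).length = p.length + 1 := by
  cases p with
  | nil => exact absurd rfl hp
  | cons d l => simp [support]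

theorem support_getElem?_succ (p : List (E × Bool)) (i : ℕ) (h : i < p.length) :
    (G.support p)[i + 1]? = some (G.head p[i]) := by
  cases p with
  | nil => simp at h
  | cons d l => simp only [support, List.getElem?_cons_succ, List.getElem?_map,
      List.getElem?_eq_getElem h, Option.map_some]

theorem support_getElem? {p : List (E × Bool)}
    (hp : p.IsChain fun d d' => G.head d = G.tail d') (i : ℕ) (h : i < p.length) :
    (G.support p)[i]? = some (G.tail p[i]) := by
  cases i with
  | zero => cases p with
    | nil => simp at h
    | cons d l => simp [support]
  | succ i =>
    rw [support_getElem?_succ p i (by omega), List.isChain_iff_getElem.1 hp i h]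

/-- A path uses each edge at most once. -/
theorem IsPath.nodup_edges {p : List (E × Bool)} (hp : G.IsPath p) :
    (p.map Prod.fst).Nodup := by
  obtain ⟨hch, hnd⟩ := hp
  rw [List.nodup_iff_pairwise_ne, List.pairwise_iff_getElem]
  intro i j hi hj hij heq
  rw [List.length_map] at hi hj
  rw [List.getElem_map, List.getElem_map] at heq
  have hlen : (G.support p).length = p.length + 1 :=
    length_support (by rintro rfl; simp at hi)
  have hinj : ∀ (a b : ℕ) (v : V), (G.support p)[a]? = some v → (G.support p)[b]? = some v → a = b := by
    intro a b v ha hb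
    exact (List.getElem?_inj (List.getElem?_eq_some_iff.1 ha).1 hnd).1 (ha.trans hb.symm)
  rcases eq_or_eq_rev heq with h | h
  · have h1 := support_getElem? hch i hi
    have h2 := support_getElem? hch j hj
    rw [h] at h1
    have := hinj _ _ _ h1 h2
    omega
  -- If the edge returns in the opposite direction, distinctness of the vertices forces both `j = i
  -- + 1` and `i = j + 1`.
  · have h1 := support_getElem?_succ (G := G) p i hi
    have h2 := support_getElem? hch j hj
    rw [h] at h2
    have hij' := hinj _ _ _ h1 h2
    have h3 := support_getElem? hch i hi
    have h4 := support_getElem?_succ (G := G) p j hj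
    rw [h, head, rev_rev] at h4
    have := hinj _ _ _ h3 h4
    omega

end Multigraph

-- Colors depend only on labels, so facial paths may be lifted to trails of richer states.
open TrailColoring in
theorem facialChoiceIndex_le_ten {E D : Type*} [Finite E] {facial : Set (List (E × Bool))}
    {lab : D → E} {R : D → D → Prop} {T : E → Bool → D} (hT : Represents lab R T)
    (h : ∀ p ∈ facial, ∃ q, IsTrail lab R q ∧ q.map lab = p.map Prod.fst) :
    facialChoiceIndex facial ≤ 10 := by
  refine iInf₂_le (10 : ℕ) fun L hL => ?_
  obtain ⟨c, hcL, hc⟩ := exists_coloring hT hL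
  refine ⟨c, hcL, fun p hp => ?_⟩
  obtain ⟨q, hq, hqp⟩ := h p hp
  have h1 : (p.map fun d => c d.1) = (p.map Prod.fst).map c := by simp
  have h2 : (q.map fun d => c (lab d)) = (q.map lab).map c := by simp
  rw [h1, ← hqp, ← h2]
  exact hc q hq

/-! ### Face traversal on surfaces. -/

namespace SurfaceGraph

variable {V E : Type*} (G : SurfaceGraph V E)

/-- The state of the face traversal that traverses the same side of the edge backwards. -/
def revState (x : (E × Bool) × ℤˣ) : (E × Bool) × ℤˣ :=
  (Multigraph.rev x.1, -(x.2 * G.sign x.1.1))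

theorem revState_revState (x : (E × Bool) × ℤˣ) : G.revState (G.revState x) = x := by
  refine Prod.ext (Multigraph.rev_rev _) ?_
  simp [revState, Multigraph.rev, mul_assoc, Int.units_mul_self]

/-- A face can be walked backwards: as `revState` is an involution, its conjugate of `faceStep` is
the inverse step. -/
theorem faceStep_revState_faceStep (x : (E × Bool) × ℤˣ) :
    G.faceStep (G.revState (G.faceStep x)) = G.revState x := by
  have hs : ∀ y, (G.revState y).2 * G.sign (G.revState y).1.1 = -y.2 := by
    intro y
    simp [revState, Multigraph.rev, mul_assoc, Int.units_mul_self]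
  have h2 : (G.faceStep x).2 = x.2 * G.sign x.1.1 := rfl
  unfold faceStep
  simp only [hs]
  rcases Int.units_eq_one_or (x.2 * G.sign x.1.1) with h | h <;>
    simp [h, revState, Multigraph.rev_rev]

theorem faceStep_injective : Function.Injective G.faceStep := by
  intro x y h
  have := congrArg (fun z => G.revState (G.faceStep (G.revState z))) h
  simpa only [faceStep_revState_faceStep, revState_revState] using this

-- An edge has four states, which `revState` pairs into two sides. The representatives are the
-- states on the dart `(e, false)`; a trail through `(e, true)` is replaced by its reversal.
open TrailColoring in
theorem represents_faceStep : Represents (fun x : (E × Bool) × ℤˣ => x.1.1)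
    (fun x y => y = G.faceStep x) (fun e b => ((e, false), if b then 1 else -1)) := by
  have hT : ∀ x : (E × Bool) × ℤˣ, x.1.2 = false →
      ∃ b : Bool, x = ((x.1.1, false), if b then 1 else -1) := by
    rintro ⟨⟨e, o⟩, s⟩ (rfl : o = false)
    rcases Int.units_eq_one_or s with rfl | rfl
    · exact ⟨true, rfl⟩
    · exact ⟨false, rfl⟩
  have hrev : ∀ x : (E × Bool) × ℤˣ, x.1.2 = true → (G.revState x).1.2 = false := by
    rintro ⟨⟨e, o⟩, s⟩ (rfl : o = true)
    rfl
  have hR : ∀ x y, y = G.faceStep x → G.revState x = G.faceStep (G.revState y) := by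
    rintro x y rfl
    exact (G.faceStep_revState_faceStep x).symm
  refine ⟨fun e b => rfl, fun _ _ _ h h' => h.trans h'.symm,
    fun _ _ _ h h' => G.faceStep_injective (h.symm.trans h'), fun x y h => ?_, fun x y h => ?_,
    fun p hp x hx => ?_⟩
  · cases hx : x.1.2
    · obtain ⟨b, hb⟩ := hT x hx
      exact ⟨b, y, rfl, Or.inl (hb ▸ h)⟩
    · obtain ⟨b, hb⟩ := hT _ (hrev x hx)
      exact ⟨b, G.revState y, rfl, Or.inr ((Eq.symm hb).trans (hR x y h))⟩
  · cases hy : y.1.2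
    · obtain ⟨b, hb⟩ := hT y hy
      exact ⟨b, x, rfl, Or.inr ((Eq.symm hb).trans h)⟩
    · obtain ⟨b, hb⟩ := hT _ (hrev y hy)
      refine ⟨b, G.revState x, rfl, Or.inl ?_⟩
      have := hR x y h
      rw [hb] at this
      exact this
  · cases hx' : x.1.2
    · obtain ⟨b, hb⟩ := hT x hx'
      exact ⟨p, hp, Or.inl rfl, b, hb ▸ hx⟩
    · obtain ⟨b, hb⟩ := hT _ (hrev x hx')
      have hlab : (p.map G.revState).reverse.map (fun x => x.1.1) =
          (p.map fun x => x.1.1).reverse := by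
        rw [List.map_reverse, List.map_map]; rfl
      refine ⟨(p.map G.revState).reverse, ⟨?_, ?_⟩, Or.inr hlab, b, ?_⟩
      · rw [List.isChain_reverse, List.isChain_map]
        exact hp.1.imp fun x y h => hR x y h
      · rw [hlab, List.nodup_reverse]
        exact hp.2
      · rw [List.mem_reverse]
        exact List.mem_map.2 ⟨x, hx, hb⟩

theorem facialThueChoiceIndex_le_ten [Finite E] : G.facialThueChoiceIndex ≤ 10 := by
  refine facialChoiceIndex_le_ten G.represents_faceStep ?_
  rintro p ⟨hp, x, hpx⟩
  have hlab : ((List.range p.length).map fun i => G.faceStep^[i] x).map (fun x => x.1.1) =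
      p.map Prod.fst := by
    conv_rhs => rw [hpx]
    rw [List.map_map, List.map_map]
    rfl
  refine ⟨(List.range p.length).map fun i => G.faceStep^[i] x, ⟨?_, ?_⟩, hlab⟩
  · rw [List.isChain_iff_getElem]
    intro i hi
    simp [Function.iterate_succ_apply']
  · rw [hlab]
    exact hp.nodup_edges

end SurfaceGraph

/-! ### Angles -/

theorem ccwAngle_mem (u w : ℂ) : ccwAngle u w ∈ Set.Ioc 0 (2 * Real.pi) := by
  simpa [ccwAngle] using toIocMod_mem_Ioc Real.two_pi_pos 0 (w / u).arg

theorem coe_ccwAngle {u w : ℂ} (hu : u ≠ 0) (hw : w ≠ 0) :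
    (ccwAngle u w : Real.Angle) = w.arg - u.arg := by
  rw [← Complex.arg_div_coe_angle hw hu, ccwAngle]
  exact Real.Angle.angle_eq_iff_two_pi_dvd_sub.2
    ⟨-toIocDiv Real.two_pi_pos 0 (w / u).arg, by
      have := toIocMod_add_toIocDiv_zsmul Real.two_pi_pos 0 (w / u).arg
      rw [zsmul_eq_mul] at this
      push_cast
      linarith⟩

theorem ccwAngle_mul_right {u w : ℂ} {r : ℝ} (hr : 0 < r) : ccwAngle u (r * w) = ccwAngle u w := by
  rw [ccwAngle, ccwAngle, mul_div_assoc, Complex.arg_real_mul _ hr]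

/-- Angles in `(0, 2π]` that agree modulo `2π` are equal. -/
theorem eq_of_coe_angle_eq {x y : ℝ} (hx : x ∈ Set.Ioc 0 (2 * Real.pi))
    (hy : y ∈ Set.Ioc 0 (2 * Real.pi)) (h : (x : Real.Angle) = y) : x = y := by
  obtain ⟨k, hk⟩ := Real.Angle.angle_eq_iff_two_pi_dvd_sub.1 h
  have hpi := Real.two_pi_pos
  have h1 : (k : ℝ) < 1 := by
    by_contra! hk1
    have := mul_le_mul_of_nonneg_left hk1 hpi.le
    linarith [hx.1, hx.2, hy.1, hy.2]
  have h2 : (-1 : ℝ) < k := by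
    by_contra! hk1
    have := mul_le_mul_of_nonneg_left hk1 hpi.le
    linarith [hx.1, hx.2, hy.1, hy.2]
  have h3 : k < 1 := by exact_mod_cast h1
  have h4 : -1 < k := by exact_mod_cast h2
  obtain rfl : k = 0 := by omega
  simp at hk
  linarith

theorem arg_eq_of_ccwAngle_right {u a b : ℂ} (hu : u ≠ 0) (ha : a ≠ 0) (hb : b ≠ 0)
    (h : ccwAngle u a = ccwAngle u b) : a.arg = b.arg := by
  have := congrArg (fun x : ℝ => (x : Real.Angle)) h
  simp only [coe_ccwAngle hu ha, coe_ccwAngle hu hb, sub_left_inj] at this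
  simpa [Complex.arg_coe_angle_eq_iff] using this

/-- If neither of the directions `a` and `b` is in the sector from the other one to `u`, then
they agree. -/
theorem arg_eq_of_ccwAngle_left {u a b : ℂ} (hu : u ≠ 0) (ha : a ≠ 0) (hb : b ≠ 0)
    (hab : ccwAngle a u ≤ ccwAngle a b) (hba : ccwAngle b u ≤ ccwAngle b a) :
    a.arg = b.arg := by
  by_contra hne
  have hpi := Real.two_pi_pos
  have hAB := ccwAngle_mem a b
  have hBA := ccwAngle_mem b a
  have hAU := ccwAngle_mem a u
  have hBU := ccwAngle_mem b u
  have hlt : ccwAngle a b < 2 * Real.pi := by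
    refine lt_of_le_of_ne hAB.2 fun h => hne ?_
    have := coe_ccwAngle ha hb
    rw [h, Real.Angle.coe_two_pi, eq_comm, sub_eq_zero] at this
    exact (Complex.arg_coe_angle_eq_iff.1 this).symm
  -- Since `u` is met no later than `b` when turning from `a`, turning from `b` to `u` passes `a`
  -- first and then goes strictly further, contradicting `hba`.
  have h1 : ccwAngle b a = 2 * Real.pi - ccwAngle a b := by
    refine eq_of_coe_angle_eq hBA ⟨by linarith, by linarith [hAB.1]⟩ ?_
    rw [Real.Angle.coe_sub, Real.Angle.coe_two_pi, coe_ccwAngle ha hb, coe_ccwAngle hb ha]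
    abel
  have h2 : ccwAngle b u = 2 * Real.pi - ccwAngle a b + ccwAngle a u := by
    refine eq_of_coe_angle_eq hBU ⟨by linarith [hAU.1], by linarith⟩ ?_
    rw [Real.Angle.coe_add, Real.Angle.coe_sub, Real.Angle.coe_two_pi, coe_ccwAngle ha hb,
      coe_ccwAngle hb hu, coe_ccwAngle ha hu]
    abel
  linarith [hAU.1]

/-! ### Face traversal in plane graphs -/

namespace PlaneGraph

variable {V E : Type*} (G : PlaneGraph V E)

/-- The arc of a dart, parametrized from its tail. -/
noncomputable def dartArc (d : E × Bool) (t : unitInterval) : ℂ :=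
  G.arc d.1 (if d.2 then unitInterval.symm t else t)

theorem continuous_dartArc (d : E × Bool) : Continuous (G.dartArc d) := by
  unfold dartArc
  cases d.2
  · simpa using (G.arc d.1).continuous
  · simpa [Function.comp_def] using (G.arc d.1).continuous.comp unitInterval.continuous_symm

theorem dartArc_zero (d : E × Bool) : G.dartArc d 0 = G.pos (G.tail d) := by
  obtain ⟨e, b⟩ := d
  cases b
  · simpa [dartArc] using G.arc_zero e
  · simpa [dartArc] using G.arc_one e

theorem dartArc_ne_pos (d : E × Bool) {t : unitInterval} (ht : t ∈ Set.Ioo 0 1) (v : V) :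
    G.dartArc d t ≠ G.pos v := by
  unfold dartArc
  cases d.2
  · simpa using G.arc_ne_pos d.1 t ht v
  · refine G.arc_ne_pos d.1 _ ?_ v
    obtain ⟨h0, h1⟩ := ht
    simp only [if_true]
    exact ⟨by simpa using unitInterval.symm_lt_symm.2 h1,
      by simpa using unitInterval.symm_lt_symm.2 h0⟩

/-- The first halves of different darts are disjoint. -/
theorem eq_of_dartArc_eq {d d' : E × Bool} {t t' : unitInterval} (ht : 0 < t) (ht' : 0 < t')
    (hh : (t : ℝ) < 1 / 2) (hh' : (t' : ℝ) < 1 / 2) (h : G.dartArc d t = G.dartArc d' t') :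
    d = d' := by
  have h0 : (0 : ℝ) < t := ht
  have h0' : (0 : ℝ) < t' := ht'
  have hmem : ∀ (b : Bool) (s : unitInterval), (0 : ℝ) < s → (s : ℝ) < 1 / 2 →
      (if b then unitInterval.symm s else s) ∈ Set.Ioo (0 : unitInterval) 1 := by
    intro b s hs hs'
    cases b
    · exact ⟨hs, show (s : ℝ) < 1 by linarith⟩
    · exact ⟨show (0 : ℝ) < 1 - s by linarith, show (1 - s : ℝ) < 1 by linarith⟩
  -- Opposite darts of one edge would need `t + t' = 1`, impossible below one half; this also
  -- separates the two darts of a loop.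
  obtain ⟨he, ht⟩ := G.arc_injective _ _ _ (hmem d.2 t h0 hh) _ (hmem d'.2 t' h0' hh') h
  obtain ⟨e, b⟩ := d
  obtain ⟨e', b'⟩ := d'
  obtain rfl : e = e' := he
  have ht := congrArg (fun s : unitInterval => (s : ℝ)) ht
  cases b <;> cases b' <;> simp [unitInterval.coe_symm_eq] at ht ⊢ <;> linarith

theorem add_smul_dir_mem_pointSet (d : E × Bool) {s : ℝ} (h0 : 0 ≤ s) (h1 : s ≤ 1) :
    G.pos (G.tail d) + s * G.dir d ∈ G.pointSet := by
  obtain ⟨δ, -, hδ⟩ := G.straight d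
  have : G.pos (G.tail d) + s * G.dir d ∈
      segment ℝ (G.pos (G.tail d)) (G.pos (G.tail d) + G.dir d) := by
    rw [segment_eq_image']
    exact ⟨s, ⟨h0, h1⟩, by simp⟩
  rw [← hδ] at this
  obtain ⟨t, -, ht⟩ := this
  exact Or.inr (Set.mem_iUnion.2 ⟨d.1, _, ht⟩)

/-- A dart runs through the points at all small distances in its direction. -/
theorem exists_dartArc_eq (d : E × Bool) : ∃ m > 0, ∀ s ∈ Set.Ioo 0 m,
    ∃ t : unitInterval, 0 < t ∧ (t : ℝ) < 1 / 2 ∧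
      G.dartArc d t = G.pos (G.tail d) + (s : ℝ) * G.dir d := by
  obtain ⟨δ, hδ0, hδ⟩ := G.straight d
  have hdir := G.dir_ne_zero d
  -- The coordinate along the direction of the dart: it starts at 0 and is positive at `η`, so the
  -- intermediate value theorem reaches every value in between.
  let f : unitInterval → ℝ := fun t => ((G.dartArc d t - G.pos (G.tail d)) / G.dir d).re
  have hf : Continuous f :=
    Complex.continuous_re.comp (((G.continuous_dartArc d).sub continuous_const).div_const _)
  have hfe : ∀ t ≤ δ, 0 ≤ f t ∧ G.dartArc d t = G.pos (G.tail d) + (f t : ℝ) * G.dir d := by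
    intro t ht
    have : G.dartArc d t ∈ segment ℝ (G.pos (G.tail d)) (G.pos (G.tail d) + G.dir d) :=
      hδ ▸ Set.mem_image_of_mem _ ht
    rw [segment_eq_image'] at this
    obtain ⟨s, ⟨hs0, -⟩, hs⟩ := this
    have hs' : G.dartArc d t = G.pos (G.tail d) + (s : ℝ) * G.dir d := by
      rw [← hs]; simp
    have hfs : f t = s := by
      simp only [f, hs', add_sub_cancel_left, mul_div_cancel_right₀ _ hdir, Complex.ofReal_re]
    rw [hfs]
    exact ⟨hs0, hs'⟩
  have h0 : f 0 = 0 := by simp [f, dartArc_zero]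
  let η : unitInterval := min δ ⟨1 / 3, by norm_num, by norm_num⟩
  have hη0 : 0 < η := lt_min hδ0 (show (0 : ℝ) < 1 / 3 by norm_num)
  have hη3 : η ≤ ⟨1 / 3, by norm_num, by norm_num⟩ := min_le_right _ _
  have hη3' : (η : ℝ) ≤ 1 / 3 := hη3
  have hpos : 0 < f η := by
    obtain ⟨h1, h2⟩ := hfe η (min_le_left _ _)
    refine lt_of_le_of_ne h1 fun h => ?_
    refine G.dartArc_ne_pos d (t := η) ⟨hη0, show (η : ℝ) < 1 by linarith⟩ (G.tail d) ?_
    rw [h2, ← h]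
    simp
  refine ⟨f η, hpos, fun s hs => ?_⟩
  obtain ⟨t, ht, hts⟩ := intermediate_value_Icc hη0.le hf.continuousOn
    (show s ∈ Set.Icc (f 0) (f η) from ⟨h0 ▸ hs.1.le, hs.2.le⟩)
  have ht' : (t : ℝ) ≤ η := ht.2
  refine ⟨t, lt_of_le_of_ne ht.1 ?_, by linarith, ?_⟩
  · rintro rfl
    rw [h0] at hts
    exact hs.1.ne hts
  · rw [← hts]
    exact (hfe t (ht.2.trans (min_le_left _ _))).2

/-- Darts leaving a vertex in the same direction are equal. -/
theorem eq_of_arg_dir_eq {d d' : E × Bool} (ht : G.tail d = G.tail d')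
    (h : (G.dir d).arg = (G.dir d').arg) : d = d' := by
  obtain ⟨r, hr, hdir⟩ : ∃ r : ℝ, 0 < r ∧ (r : ℂ) * G.dir d = G.dir d' := by
    have hn := norm_pos_iff.2 (G.dir_ne_zero d)
    have hn' := norm_pos_iff.2 (G.dir_ne_zero d')
    refine ⟨‖G.dir d'‖ / ‖G.dir d‖, by positivity, ?_⟩
    have := (Complex.arg_eq_arg_iff (G.dir_ne_zero d) (G.dir_ne_zero d')).1 h
    push_cast
    exact this
  obtain ⟨m, hm, H⟩ := G.exists_dartArc_eq d
  obtain ⟨m', hm', H'⟩ := G.exists_dartArc_eq d'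
  -- Small enough that both darts run through the same point of their common ray.
  let s := min (m / (2 * r)) (m' / 2)
  have hs0 : 0 < s := lt_min (by positivity) (by positivity)
  have hs1 : r * s < m := by
    have : s ≤ m / (2 * r) := min_le_left _ _
    calc r * s ≤ r * (m / (2 * r)) := by gcongr
      _ = m / 2 := by field_simp
      _ < m := by linarith
  have hs2 : s < m' := (min_le_right _ _).trans_lt (by linarith)
  obtain ⟨t, ht0, hth, hte⟩ := H (r * s) ⟨by positivity, hs1⟩
  obtain ⟨t', ht0', hth', hte'⟩ := H' s ⟨hs0, hs2⟩
  refine G.eq_of_dartArc_eq ht0 ht0' hth hth' ?_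
  rw [hte, hte', ht, ← hdir]
  push_cast
  ring

/-- No dart lies in the angle between consecutive darts on the boundary of a face. -/
theorem FollowsOn.ccwAngle_le {G : PlaneGraph V E} {F : Set ℂ} (hF : G.IsFace F)
    {d d' x : E × Bool} (h : G.FollowsOn F d d') (hx : G.tail x = G.tail d') :
    ccwAngle (G.dir d') (G.dir (Multigraph.rev d)) ≤ ccwAngle (G.dir d') (G.dir x) := by
  by_contra! hlt
  obtain ⟨-, ε, hε, hsub⟩ := h
  obtain ⟨z, -, rfl⟩ := hF
  have hn := norm_pos_iff.2 (G.dir_ne_zero x)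
  -- A point of the straight piece of `x` inside the ball; it would lie in the sector, hence in the
  -- face, although it belongs to the drawing.
  let s := min 1 (ε / (2 * ‖G.dir x‖))
  have hs0 : 0 < s := lt_min one_pos (by positivity)
  have hmem := G.add_smul_dir_mem_pointSet x hs0.le (min_le_left _ _)
  refine connectedComponentIn_subset _ _ (hsub ⟨?_, ?_⟩) hmem
  · rw [hx, Metric.mem_ball, dist_eq_norm, add_sub_cancel_left, norm_mul, Complex.norm_real,
      Real.norm_of_nonneg hs0.le]
    calc s * ‖G.dir x‖ ≤ ε / (2 * ‖G.dir x‖) * ‖G.dir x‖ := by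
          gcongr; exact min_le_right _ _
      _ = ε / 2 := by field_simp
      _ < ε := by linarith
  · rw [openSector, Set.mem_ofPred_eq, hx, add_sub_cancel_left, ccwAngle_mul_right hs0]
    exact hlt

-- Faces are kept on the left, so the two darts of an edge already stand for its two sides and no
-- reversal is needed. Bi-uniqueness holds because no dart enters the angle between consecutive
-- darts, so two successors, or two predecessors, have the same direction at the vertex.
open TrailColoring in
theorem represents_followsOn : Represents Prod.fst
    (fun d d' => ∃ F, G.IsFace F ∧ G.FollowsOn F d d') Prod.mk := by
  refine ⟨fun _ _ => rfl, ?_, ?_, ?_, ?_, ?_⟩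
  · rintro d d₁ d₂ ⟨F₁, hF₁, h₁⟩ ⟨F₂, hF₂, h₂⟩
    have ht : G.tail d₁ = G.tail d₂ := h₁.1.symm.trans h₂.1
    exact G.eq_of_arg_dir_eq ht (arg_eq_of_ccwAngle_left (G.dir_ne_zero (Multigraph.rev d))
      (G.dir_ne_zero _) (G.dir_ne_zero _) (h₁.ccwAngle_le hF₁ ht.symm) (h₂.ccwAngle_le hF₂ ht))
  · rintro d₁ d₂ d ⟨F₁, hF₁, h₁⟩ ⟨F₂, hF₂, h₂⟩
    have h := (h₁.ccwAngle_le hF₁ (x := Multigraph.rev d₂) h₂.1).antisymm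
      (h₂.ccwAngle_le hF₂ (x := Multigraph.rev d₁) h₁.1)
    have := G.eq_of_arg_dir_eq (d := Multigraph.rev d₁) (d' := Multigraph.rev d₂)
      (h₁.1.trans h₂.1.symm) (arg_eq_of_ccwAngle_right (G.dir_ne_zero d)
        (G.dir_ne_zero _) (G.dir_ne_zero _) h)
    rw [← Multigraph.rev_rev d₁, this, Multigraph.rev_rev]
  · exact fun d d' h => ⟨d.2, d', rfl, Or.inl h⟩
  · exact fun d d' h => ⟨d'.2, d, rfl, Or.inr h⟩
  · exact fun p hp d hd => ⟨p, hp, Or.inl rfl, d.2, hd⟩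

theorem facialThueChoiceIndex_le_ten [Finite E] : G.facialThueChoiceIndex ≤ 10 := by
  refine facialChoiceIndex_le_ten G.represents_followsOn ?_
  rintro p ⟨hp, F, hF, hch⟩
  exact ⟨p, ⟨hch.imp fun d d' h => ⟨F, hF, h⟩, hp.nodup_edges⟩, rfl⟩

end PlaneGraph

theorem mainTheorem4 {V E : Type*} [Finite V] [Finite E] :
    (∀ G : PlaneGraph V E, G.facialThueChoiceIndex ≤ 10) ∧
    (∀ G : SurfaceGraph V E, G.facialThueChoiceIndex ≤ 10) := by
  exact ⟨fun G => G.facialThueChoiceIndex_le_ten, fun G => G.facialThueChoiceIndex_le_ten⟩
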